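/- Let $\mathbb{F}=abaababa\cdots$ be the Fibonacci word, the infinite word over $\{a,b\}$ that begins with $a$ and is fixed by the morphism $a\mapsto ab$, $b\mapsto a$. Let the Fibonacci numbers be normalized by $f_{-2}=0$, $f_{-1}=1$ and $f_m=f_{m-1}+f_{m-2}$ for $m\ge 0$ (so $f_0=1$, $f_1=2$, $f_2=3$). For a nonempty finite word $\omega$ occurring in $\mathbb{F}$ and $p\ge 1$, let $\omega_p$ denote the $p$-th occurrence of $\omega$ in $\mathbb{F}$, counted from left to right (occurrences may overlap). For $n\ge 1$ let $A(n)$ be the number of pairs $(\omega,p)$ such that $\omega$ is a nonempty palindrome occurring in $\mathbb{F}$, $p\ge1$, and the occurrence $\omega_p$ is contained in the prefix of $\mathbb{F}$ of length $n$. Then for every integer $m\ge 0$, $$A(f_m)=\frac{m-3}{5}\,f_{m+2}+\frac{m-1}{5}\,f_m+m+3 .$$ -/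

import Mathlib

namespace FibPal

/-- The alphabet `{a, b}`. -/
inductive Letter where
  | a : Letter
  | b : Letter
deriving DecidableEq

/-- The Fibonacci morphism on letters: `a ↦ ab`, `b ↦ a`. -/
def sigmaLetter : Letter → List Letter
  | Letter.a => [Letter.a, Letter.b]
  | Letter.b => [Letter.a]

/-- The Fibonacci morphism on finite words. -/
def sigma (w : List Letter) : List Letter := w.flatMap sigmaLetter

/-- The finite Fibonacci words `F_m = σ^m(a)`, `m ≥ 0`. -/
def fibWord (m : ℕ) : List Letter := sigma^[m] [Letter.a]

/-- The Fibonacci sequence. Positions are counted from `0` here, so that `fibSeq k` is the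
`(k+1)`-st letter; the default value `a` of `getD` is never used, because `F_k` has more than `k`
letters (`lt_length_fibWord`). That this is the fixed point of the morphism beginning with `a` is
`fibSeq_zero`, `fibSeq_fixed` and `fibSeq_unique`. -/
def fibSeq (k : ℕ) : Letter := (fibWord k).getD k Letter.a

/-- The block of length `n` of the infinite word `s` that starts at (0-based) position `i`. -/
def block (s : ℕ → Letter) (i n : ℕ) : List Letter := (List.range n).map fun k => s (i + k)

/-- The infinite word `s` is a fixed point of the morphism beginning with `a`: the image of each of
its prefixes is again a prefix of it. -/
def IsFixedPointFromA (s : ℕ → Letter) : Prop :=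
  s 0 = Letter.a ∧ ∀ n : ℕ, sigma (block s 0 n) = block s 0 (sigma (block s 0 n)).length

/-- The word `ω` occurs in the Fibonacci sequence at (0-based) position `i`. -/
def OccursAt (ω : List Letter) (i : ℕ) : Prop := block fibSeq i ω.length = ω

/-- The `p`-th occurrence `ω_p` of `ω` in the Fibonacci sequence (`p = 1, 2, …`, from left to right)
starts at (0-based) position `i`. -/
def IsPthOccurrence (ω : List Letter) (p i : ℕ) : Prop :=
  OccursAt ω i ∧ {j : ℕ | j ≤ i ∧ OccursAt ω j}.ncard = p

/-- The pairs `(ω, p)` with `ω` a nonempty palindrome occurring in the Fibonacci sequence, `p ≥ 1`,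
and the `p`-th occurrence of `ω` contained in the prefix of length `n`. -/
def palindromeOccurrences (n : ℕ) : Set (List Letter × ℕ) :=
  {x | x.1 ≠ [] ∧ x.1.Palindrome ∧ 1 ≤ x.2 ∧
    ∃ i : ℕ, IsPthOccurrence x.1 x.2 i ∧ i + x.1.length ≤ n}

/-- The number `A(n)` of repeated palindromes in the prefix of length `n`. -/
noncomputable def A (n : ℕ) : ℕ := (palindromeOccurrences n).ncard

/-- The Fibonacci numbers `f_m`, `m ≥ 0`, normalized by `f_{-2} = 0`, `f_{-1} = 1`, so that `f_0 = 1`,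
`f_1 = 2`, `f_2 = 3`. -/
def f (m : ℕ) : ℕ := Nat.fib (m + 2)

theorem sigma_append (u v : List Letter) : sigma (u ++ v) = sigma u ++ sigma v := by
  simp [sigma]

theorem fibWord_succ (m : ℕ) : fibWord (m + 1) = sigma (fibWord m) := by
  simp only [fibWord, Function.iterate_succ_apply']

theorem length_le_sigma (u : List Letter) : u.length ≤ (sigma u).length := by
  induction u with
  | nil => simp
  | cons x u ih => cases x <;> simp [sigma, sigmaLetter] at * <;> omega

theorem fibWord_head (m : ℕ) : ∃ u, fibWord m = Letter.a :: u := by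
  induction m with
  | zero => exact ⟨[], rfl⟩
  | succ m ih =>
    obtain ⟨u, hu⟩ := ih
    exact ⟨Letter.b :: sigma u, by rw [fibWord_succ, hu]; simp [sigma, sigmaLetter]⟩

theorem lt_length_fibWord (m : ℕ) : m < (fibWord m).length := by
  induction m with
  | zero => simp [fibWord]
  | succ m ih =>
    obtain ⟨u, hu⟩ := fibWord_head m
    have h := length_le_sigma u
    rw [hu] at ih
    rw [fibWord_succ, hu]
    simp [sigma, sigmaLetter] at *
    omega

theorem sigma_prefix {u v : List Letter} (h : u <+: v) : sigma u <+: sigma v := by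
  obtain ⟨t, rfl⟩ := h
  exact ⟨sigma t, (sigma_append u t).symm⟩

theorem fibWord_prefix_succ (m : ℕ) : fibWord m <+: fibWord (m + 1) := by
  induction m with
  | zero => exact ⟨[Letter.b], rfl⟩
  | succ m ih => rw [fibWord_succ m, fibWord_succ (m + 1)]; exact sigma_prefix ih

theorem fibWord_prefix {m n : ℕ} (h : m ≤ n) : fibWord m <+: fibWord n := by
  induction n, h using Nat.le_induction with
  | base => exact List.prefix_rfl
  | succ n _ ih => exact ih.trans (fibWord_prefix_succ n)

theorem block_length (s : ℕ → Letter) (i n : ℕ) : (block s i n).length = n := by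
  simp [block]

theorem block_prefix (s : ℕ → Letter) {m n : ℕ} (h : m ≤ n) : block s 0 m <+: block s 0 n := by
  obtain ⟨k, rfl⟩ := Nat.exists_eq_add_of_le h
  simp [block, List.range_add]

/-- Every finite Fibonacci word is a prefix of the Fibonacci sequence. -/
theorem fibWord_eq_block (m : ℕ) : fibWord m = block fibSeq 0 (fibWord m).length := by
  apply List.ext_getElem
  · simp [block_length]
  · intro k h1 h2
    have hk := lt_length_fibWord k
    simp only [block, List.getElem_map, List.getElem_range, zero_add, fibSeq,
      List.getD_eq_getElem _ _ hk]
    rcases le_total m k with h | h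
    · exact (fibWord_prefix h).getElem h1
    · exact ((fibWord_prefix h).getElem hk).symm

theorem fibSeq_zero : fibSeq 0 = Letter.a := rfl

theorem fibSeq_fixed : IsFixedPointFromA fibSeq := by
  refine ⟨rfl, fun n => ?_⟩
  have h1 : block fibSeq 0 n <+: fibWord n := by
    rw [fibWord_eq_block n]; exact block_prefix _ (lt_length_fibWord n).le
  have h2 := sigma_prefix h1
  rw [← fibWord_succ, fibWord_eq_block] at h2
  have h3 := h2.length_le
  rw [block_length] at h3
  exact List.IsPrefix.eq_of_length
    (List.prefix_of_prefix_length_le h2 (block_prefix _ h3) (by simp [block_length]))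
    (by simp [block_length])

theorem fibSeq_unique (s : ℕ → Letter) (hs : IsFixedPointFromA s) : s = fibSeq := by
  have key : ∀ m, fibWord m = block s 0 (fibWord m).length := by
    intro m
    induction m with
    | zero => simp [fibWord, block, hs.1]
    | succ m ih =>
      have h := hs.2 (fibWord m).length
      rw [← ih, ← fibWord_succ] at h
      exact h
  funext k
  have hk := lt_length_fibWord k
  have h : block s 0 (fibWord k).length = block fibSeq 0 (fibWord k).length :=
    (key k).symm.trans (fibWord_eq_block k)
  have h' := congrArg (fun l => l[k]?) h
  simpa [block, hk] using h'

end FibPal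

namespace FibPal

/-! A pair `(ω, p)` amounts to an interval of positions carrying a palindrome
(`A_eq_card_palIntervals`), so intervals are counted, by desubstitution. Write `P(n)` for their
number in the prefix of length `n`, with `P_a`, `P_b` for those starting with `a`, `b`. The
palindromic factors starting with `a` are the words `σ(u)a`, `u` a palindromic factor or empty
(`isPal_from_a_iff`). Those starting with `b` are `σ(u)a` stripped of its two outer `a`s, with `u`
starting with `a` (`isPal_from_b_iff`). As `σ` maps the prefix of length `f_m` to that of length
`f_{m+1}`, this gives `P_b(f_{m+1}) = P_a(f_m)` and `P_a(f_{m+1}) = P(f_m - 1) + f_m`. Passing from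
`P(f_m - 1)` to `P(f_m)` costs the number of palindromic suffixes of `F_m`, found by the same
desubstitution. The outcome is the recurrence `P(f_{m+2}) = P(f_{m+1}) + P(f_m) + f_{m+2} - (m +
2)`, which the closed form solves: the forcing term `f_{m+2}` is resonant and produces the products
of `m` with Fibonacci numbers, while `m + 3` absorbs `-(m + 2)`. -/

theorem block_succ (s : ℕ → Letter) (i n : ℕ) : block s i (n + 1) = block s i n ++ [s (i + n)] := by
  simp [block, List.range_succ]

theorem block_add (s : ℕ → Letter) (i m n : ℕ) :
    block s i (m + n) = block s i m ++ block s (i + m) n := by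
  simp [block, List.range_add, add_assoc]

/-! ### Desubstitution of positions -/

/-- The position at which the image of the `n`-th letter of the Fibonacci sequence starts. -/
def sigmaPos (n : ℕ) : ℕ := (sigma (block fibSeq 0 n)).length

theorem sigmaPos_add (i n : ℕ) :
    sigmaPos (i + n) = sigmaPos i + (sigma (block fibSeq i n)).length := by
  simp [sigmaPos, block_add, sigma_append]

theorem sigma_block (i n : ℕ) :
    sigma (block fibSeq i n) =
      block fibSeq (sigmaPos i) (sigma (block fibSeq i n)).length := by
  have h : sigma (block fibSeq 0 (i + n)) = block fibSeq 0 (sigmaPos (i + n)) :=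
    fibSeq_fixed.2 (i + n)
  have hi : sigma (block fibSeq 0 i) = block fibSeq 0 (sigmaPos i) := fibSeq_fixed.2 i
  rw [sigmaPos_add, block_add, block_add, sigma_append, hi, zero_add, zero_add] at h
  exact List.append_cancel_left h

theorem sigmaPos_succ (n : ℕ) :
    sigmaPos (n + 1) = sigmaPos n + (sigmaLetter (fibSeq n)).length := by
  rw [sigmaPos_add]; simp [block, sigma]

theorem sigmaPos_succ_of_a {n : ℕ} (h : fibSeq n = Letter.a) :
    sigmaPos (n + 1) = sigmaPos n + 2 := by
  rw [sigmaPos_succ, h]; rfl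

theorem sigmaPos_succ_of_b {n : ℕ} (h : fibSeq n = Letter.b) :
    sigmaPos (n + 1) = sigmaPos n + 1 := by
  rw [sigmaPos_succ, h]; rfl

theorem sigmaPos_strictMono : StrictMono sigmaPos := by
  refine strictMono_nat_of_lt_succ fun n => ?_
  rw [sigmaPos_succ]
  cases fibSeq n <;> simp [sigmaLetter]

theorem fibSeq_sigmaPos (n : ℕ) : fibSeq (sigmaPos n) = Letter.a := by
  have h := sigma_block n 1
  cases hn : fibSeq n <;> simp_all [block, sigma, sigmaLetter, List.range_succ]

theorem fibSeq_sigmaPos_add_one {n : ℕ} (hn : fibSeq n = Letter.a) :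
    fibSeq (sigmaPos n + 1) = Letter.b := by
  have h := sigma_block n 1
  simp_all [block, sigma, sigmaLetter, List.range_succ]

theorem exists_sigmaPos (x : ℕ) :
    ∃ i, x = sigmaPos i ∨ (fibSeq i = Letter.a ∧ x = sigmaPos i + 1) := by
  induction x with
  | zero => exact ⟨0, Or.inl rfl⟩
  | succ x ih =>
    obtain ⟨i, rfl | ⟨hi, rfl⟩⟩ := ih
    · cases hi : fibSeq i with
      | a => exact ⟨i, Or.inr ⟨hi, rfl⟩⟩
      | b => exact ⟨i + 1, Or.inl (sigmaPos_succ_of_b hi).symm⟩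
    · exact ⟨i + 1, Or.inl (sigmaPos_succ_of_a hi).symm⟩

theorem exists_sigmaPos_of_a {x : ℕ} (h : fibSeq x = Letter.a) : ∃ i, x = sigmaPos i := by
  obtain ⟨i, rfl | ⟨hi, rfl⟩⟩ := exists_sigmaPos x
  · exact ⟨i, rfl⟩
  · rw [fibSeq_sigmaPos_add_one hi] at h; cases h

theorem exists_sigmaPos_of_b {x : ℕ} (h : fibSeq x = Letter.b) :
    ∃ i, fibSeq i = Letter.a ∧ x = sigmaPos i + 1 := by
  obtain ⟨i, rfl | hi⟩ := exists_sigmaPos x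
  · rw [fibSeq_sigmaPos] at h; cases h
  · exact ⟨i, hi⟩

/-! ### Palindromes under the morphism -/

/-- The morphism `σ` and its conjugate `a ↦ ba`, `b ↦ a` are exchanged by reversal. -/
theorem reverse_sigma_append (w : List Letter) :
    (sigma w ++ [Letter.a]).reverse = sigma w.reverse ++ [Letter.a] := by
  induction w with
  | nil => rfl
  | cons x u ih =>
    have h : sigma (x :: u) ++ [Letter.a] = sigmaLetter x ++ (sigma u ++ [Letter.a]) := by
      simp [sigma]
    rw [h, List.reverse_append, ih, List.reverse_cons, sigma_append]
    cases x <;> simp [sigma, sigmaLetter]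

theorem sigma_cons_ne_b (w u : List Letter) : sigma w ≠ Letter.b :: u := by
  rcases w with _ | ⟨_ | _, w⟩ <;> simp [sigma, sigmaLetter]

/-- Decoding is forced: every letter image starts with `a`, and whether a `b` follows tells `ab`
from `a`. -/
theorem sigma_injective : Function.Injective sigma := by
  intro u
  induction u with
  | nil => rintro (_ | ⟨_ | _, v⟩) h <;> simp_all [sigma, sigmaLetter]
  | cons x u ih =>
    have cons_a (w : List Letter) :
        sigma (Letter.a :: w) = Letter.a :: Letter.b :: sigma w := rfl
    have cons_b (w : List Letter) : sigma (Letter.b :: w) = Letter.a :: sigma w := rfl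
    rintro (_ | ⟨y, v⟩) h
    · cases x <;> simp [sigma, sigmaLetter] at h
    · cases x <;> cases y <;> simp only [cons_a, cons_b, List.cons.injEq, true_and] at h
      · rw [ih h]
      · exact absurd h.symm (sigma_cons_ne_b _ _)
      · exact absurd h (sigma_cons_ne_b _ _)
      · rw [ih h]

/-- The factor of the Fibonacci sequence on the interval `[i, j)` of positions is a palindrome. -/
def IsPal (i j : ℕ) : Prop :=
  (block fibSeq i (j - i)).reverse = block fibSeq i (j - i)

instance (i j : ℕ) : Decidable (IsPal i j) := by unfold IsPal; infer_instance

theorem isPal_self (i : ℕ) : IsPal i i := by simp [IsPal, block]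

/-- The extra position holds the `a` that opens the next letter image, so the factor is `σ(u)a`,
whose reversal is `σ` of the reversal of `u`, followed by `a`; injectivity of `σ` concludes. -/
theorem isPal_sigmaPos {i j : ℕ} (h : i ≤ j) :
    IsPal (sigmaPos i) (sigmaPos j + 1) ↔ IsPal i j := by
  obtain ⟨n, rfl⟩ := Nat.exists_eq_add_of_le h
  have e : block fibSeq (sigmaPos i) (sigmaPos (i + n) + 1 - sigmaPos i) =
      sigma (block fibSeq i n) ++ [Letter.a] := by
    have : sigmaPos (i + n) + 1 - sigmaPos i = (sigma (block fibSeq i n)).length + 1 := by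
      rw [sigmaPos_add]; omega
    rw [this, block_succ, ← sigma_block, ← sigmaPos_add, fibSeq_sigmaPos]
  rw [IsPal, IsPal, e, reverse_sigma_append, Nat.add_sub_cancel_left, List.append_cancel_right_eq,
    sigma_injective.eq_iff]

theorem isPal_succ_right {i j : ℕ} (h : i < j) :
    IsPal i (j + 1) ↔ fibSeq i = fibSeq j ∧ IsPal (i + 1) j := by
  obtain ⟨n, rfl⟩ := Nat.exists_eq_add_of_lt h
  have e : block fibSeq i (i + n + 1 + 1 - i) =
      fibSeq i :: (block fibSeq (i + 1) n ++ [fibSeq (i + n + 1)]) := by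
    have : i + n + 1 + 1 - i = 1 + n + 1 := by omega
    rw [this, block_succ, block_add, show i + (1 + n) = i + n + 1 by omega]
    simp [block]
  have e' : i + n + 1 - (i + 1) = n := by omega
  rw [IsPal, IsPal, e, e', List.reverse_cons, List.reverse_append]
  simp only [List.reverse_cons, List.reverse_nil, List.nil_append, List.cons_append,
    List.cons.injEq]
  constructor
  · rintro ⟨h1, h2⟩
    exact ⟨h1.symm, List.append_inj_left' h2 rfl⟩
  · rintro ⟨h1, h2⟩
    exact ⟨h1.symm, by rw [h1, h2]⟩

theorem IsPal.fibSeq_eq {i j : ℕ} (h : IsPal i (j + 1)) (hij : i ≤ j) : fibSeq i = fibSeq j := by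
  rcases hij.eq_or_lt with rfl | hlt
  · rfl
  · exact ((isPal_succ_right hlt).1 h).1

/-- Removing both end letters `a` of `σ(u)a` does not affect being a palindrome; `i < j` makes them
two different positions. -/
theorem isPal_sigmaPos_add_one {i j : ℕ} (h : i < j) :
    IsPal (sigmaPos i + 1) (sigmaPos j) ↔ IsPal i j := by
  rw [← isPal_sigmaPos h.le, isPal_succ_right (sigmaPos_strictMono h), fibSeq_sigmaPos,
    fibSeq_sigmaPos, eq_self_iff_true, true_and]

/-- Palindromic intervals starting with `a` come from palindromic intervals, empty ones included. -/
theorem isPal_from_a_iff {x y : ℕ} :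
    (x < y ∧ IsPal x y ∧ fibSeq x = Letter.a) ↔
      ∃ i j, i ≤ j ∧ IsPal i j ∧ x = sigmaPos i ∧ y = sigmaPos j + 1 := by
  constructor
  · rintro ⟨hxy, hp, hx⟩
    obtain ⟨y, rfl⟩ := Nat.exists_eq_add_of_le' (Nat.one_le_of_lt hxy)
    have hy := (hp.fibSeq_eq (by omega)).symm.trans hx
    obtain ⟨i, rfl⟩ := exists_sigmaPos_of_a hx
    obtain ⟨j, rfl⟩ := exists_sigmaPos_of_a hy
    have hij : i ≤ j := sigmaPos_strictMono.le_iff_le.1 (by omega)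
    exact ⟨i, j, hij, (isPal_sigmaPos hij).1 hp, rfl, rfl⟩
  · rintro ⟨i, j, hij, hp, rfl, rfl⟩
    have := sigmaPos_strictMono.monotone hij
    exact ⟨by omega, (isPal_sigmaPos hij).2 hp, fibSeq_sigmaPos i⟩

/-- Palindromic intervals starting with `b` come from those starting with `a`. -/
theorem isPal_from_b_iff {x y : ℕ} :
    (x < y ∧ IsPal x y ∧ fibSeq x = Letter.b) ↔
      ∃ i j, i < j ∧ IsPal i j ∧ fibSeq i = Letter.a ∧ x = sigmaPos i + 1 ∧ y = sigmaPos j := by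
  constructor
  · rintro ⟨hxy, hp, hx⟩
    obtain ⟨y, rfl⟩ := Nat.exists_eq_add_of_le' (Nat.one_le_of_lt hxy)
    have hy := (hp.fibSeq_eq (by omega)).symm.trans hx
    obtain ⟨i, hi, rfl⟩ := exists_sigmaPos_of_b hx
    obtain ⟨j, hj, rfl⟩ := exists_sigmaPos_of_b hy
    have hij : i ≤ j := sigmaPos_strictMono.le_iff_le.1 (by omega)
    -- The final `b` completes the image `ab` of the letter at `j`, so the interval ends where the
    -- next image starts.
    rw [add_assoc, ← sigmaPos_succ_of_a hj] at hp
    exact ⟨i, j + 1, by omega, (isPal_sigmaPos_add_one (by omega)).1 hp, hi, rfl,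
      (sigmaPos_succ_of_a hj).symm⟩
  · rintro ⟨i, j, hij, hp, hi, rfl, rfl⟩
    have h1 := sigmaPos_succ_of_a hi
    have h2 := sigmaPos_strictMono.monotone (Nat.succ_le_of_lt hij)
    rw [Nat.succ_eq_add_one] at h2
    exact ⟨by omega, (isPal_sigmaPos_add_one hij).2 hp, fibSeq_sigmaPos_add_one hi⟩

/-! ### Counting palindromic intervals -/

/-- The nonempty intervals in the prefix of length `n` on which the sequence is a palindrome. -/
def palIntervals (n : ℕ) : Finset (ℕ × ℕ) :=
  (Finset.range (n + 1) ×ˢ Finset.range (n + 1)).filter fun x => x.1 < x.2 ∧ IsPal x.1 x.2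

/-- The palindromic intervals that start with the letter `c`. -/
def palIntervalsFrom (c : Letter) (n : ℕ) : Finset (ℕ × ℕ) :=
  (palIntervals n).filter fun x => fibSeq x.1 = c

/-- The starting points of the palindromic suffixes, including the empty one, of the prefix of
length `n`. -/
def palSuffixes (n : ℕ) : Finset ℕ := (Finset.range (n + 1)).filter fun i => IsPal i n

theorem mem_palIntervals {n : ℕ} {x : ℕ × ℕ} :
    x ∈ palIntervals n ↔ x.1 < x.2 ∧ x.2 ≤ n ∧ IsPal x.1 x.2 := by
  simp only [palIntervals, Finset.mem_filter, Finset.mem_product, Finset.mem_range]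
  constructor
  · rintro ⟨⟨_, _⟩, _, hp⟩; exact ⟨by omega, by omega, hp⟩
  · rintro ⟨_, _, hp⟩; exact ⟨⟨by omega, by omega⟩, by omega, hp⟩

theorem mem_palIntervalsFrom {c : Letter} {n : ℕ} {x : ℕ × ℕ} :
    x ∈ palIntervalsFrom c n ↔ x.2 ≤ n ∧ x.1 < x.2 ∧ IsPal x.1 x.2 ∧ fibSeq x.1 = c := by
  rw [palIntervalsFrom, Finset.mem_filter, mem_palIntervals]; tauto

theorem mem_palSuffixes {n i : ℕ} : i ∈ palSuffixes n ↔ i ≤ n ∧ IsPal i n := by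
  rw [palSuffixes, Finset.mem_filter, Finset.mem_range, Nat.lt_succ_iff]

theorem card_palIntervals_eq (n : ℕ) :
    (palIntervals n).card =
      (palIntervalsFrom Letter.a n).card + (palIntervalsFrom Letter.b n).card := by
  rw [← Finset.card_filter_add_card_filter_not (fun x : ℕ × ℕ => fibSeq x.1 = Letter.a)]
  congr 2
  refine Finset.filter_congr fun x _ => ?_
  cases fibSeq x.1 <;> simp

theorem card_palIntervalsFrom_b (n : ℕ) :
    (palIntervalsFrom Letter.b (sigmaPos n)).card = (palIntervalsFrom Letter.a n).card := by
  symm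
  refine Finset.card_bij (fun x _ => (sigmaPos x.1 + 1, sigmaPos x.2)) ?_ ?_ ?_
  · rintro ⟨i, j⟩ h
    obtain ⟨hj, hij, hp, ha⟩ := mem_palIntervalsFrom.1 h
    exact mem_palIntervalsFrom.2 ⟨sigmaPos_strictMono.monotone hj,
      isPal_from_b_iff.2 ⟨i, j, hij, hp, ha, rfl, rfl⟩⟩
  · rintro ⟨i, j⟩ _ ⟨i', j'⟩ _ h
    simp only [Prod.mk.injEq, Nat.add_right_cancel_iff, sigmaPos_strictMono.injective.eq_iff] at h
    rw [h.1, h.2]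
  · rintro ⟨x, y⟩ h
    obtain ⟨hy, h⟩ := mem_palIntervalsFrom.1 h
    obtain ⟨i, j, hij, hp, ha, rfl, rfl⟩ := isPal_from_b_iff.1 h
    exact ⟨(i, j), mem_palIntervalsFrom.2 ⟨sigmaPos_strictMono.le_iff_le.1 hy, hij, hp, ha⟩, rfl⟩

/-- The summand `n + 1` counts the empty intervals at `0, ..., n`, which produce the single letters
`a`. The bound drops from `n + 1` to `n` because the image interval reaches one letter into the next
letter image. -/
theorem card_palIntervalsFrom_a (n : ℕ) :
    (palIntervalsFrom Letter.a (sigmaPos (n + 1))).card = (palIntervals n).card + (n + 1) := by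
  have hd : Disjoint (palIntervals n) (Finset.range (n + 1)).diag := by
    rw [Finset.disjoint_left]
    rintro x hx hx'
    have := (mem_palIntervals.1 hx).1
    have := (Finset.mem_diag.1 hx').2
    omega
  have hmem (i j : ℕ) : (i, j) ∈ palIntervals n ∪ (Finset.range (n + 1)).diag ↔
      i ≤ j ∧ j ≤ n ∧ IsPal i j := by
    rw [Finset.mem_union, mem_palIntervals, Finset.mem_diag, Finset.mem_range]
    constructor
    · rintro (⟨h1, h2, hp⟩ | ⟨h1, h2⟩)
      · exact ⟨h1.le, h2, hp⟩
      · dsimp only at h1 h2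
        subst h2
        exact ⟨le_rfl, by omega, isPal_self i⟩
    · rintro ⟨h1, h2, hp⟩
      rcases h1.eq_or_lt with rfl | h1
      · exact Or.inr ⟨by omega, rfl⟩
      · exact Or.inl ⟨h1, h2, hp⟩
  have hc : (palIntervals n ∪ (Finset.range (n + 1)).diag).card =
      (palIntervals n).card + (n + 1) := by
    rw [Finset.card_union_of_disjoint hd, Finset.diag_card, Finset.card_range]
  rw [← hc]
  symm
  refine Finset.card_bij (fun x _ => (sigmaPos x.1, sigmaPos x.2 + 1)) ?_ ?_ ?_
  · rintro ⟨i, j⟩ h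
    obtain ⟨hij, hj, hp⟩ := (hmem i j).1 h
    exact mem_palIntervalsFrom.2 ⟨sigmaPos_strictMono (Nat.lt_succ_of_le hj),
      isPal_from_a_iff.2 ⟨i, j, hij, hp, rfl, rfl⟩⟩
  · rintro ⟨i, j⟩ _ ⟨i', j'⟩ _ h
    simp only [Prod.mk.injEq, Nat.add_right_cancel_iff, sigmaPos_strictMono.injective.eq_iff] at h
    rw [h.1, h.2]
  · rintro ⟨x, y⟩ h
    obtain ⟨hy, h⟩ := mem_palIntervalsFrom.1 h
    obtain ⟨i, j, hij, hp, rfl, rfl⟩ := isPal_from_a_iff.1 h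
    have hj : j < n + 1 := sigmaPos_strictMono.lt_iff_lt.1 hy
    exact ⟨(i, j), (hmem i j).2 ⟨hij, by omega, hp⟩, rfl⟩

/-- The new intervals are those ending at `n + 1`; the `1` on the left offsets the empty suffix. -/
theorem card_palIntervals_succ (n : ℕ) :
    (palIntervals (n + 1)).card + 1 = (palIntervals n).card + (palSuffixes (n + 1)).card := by
  have hs : n + 1 ∈ palSuffixes (n + 1) := mem_palSuffixes.2 ⟨le_rfl, isPal_self _⟩
  have hd : Disjoint (palIntervals n)
      (((palSuffixes (n + 1)).erase (n + 1)).image fun i => (i, n + 1)) := by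
    rw [Finset.disjoint_left]
    rintro x hx hx'
    obtain ⟨i, _, rfl⟩ := Finset.mem_image.1 hx'
    have := (mem_palIntervals.1 hx).2.1
    dsimp only at this
    omega
  have hu : palIntervals (n + 1) = palIntervals n ∪
      (((palSuffixes (n + 1)).erase (n + 1)).image fun i => (i, n + 1)) := by
    ext ⟨i, j⟩
    simp only [Finset.mem_union, Finset.mem_image, Finset.mem_erase, mem_palIntervals,
      mem_palSuffixes, Prod.mk.injEq]
    constructor
    · rintro ⟨h1, h2, hp⟩
      rcases h2.eq_or_lt with rfl | h2
      · exact Or.inr ⟨i, ⟨h1.ne, h1.le, hp⟩, rfl, rfl⟩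
      · exact Or.inl ⟨h1, by omega, hp⟩
    · rintro (⟨h1, h2, hp⟩ | ⟨i, ⟨h1, h2, hp⟩, rfl, rfl⟩)
      · exact ⟨h1, by omega, hp⟩
      · exact ⟨by omega, le_rfl, hp⟩
  rw [hu, Finset.card_union_of_disjoint hd,
    Finset.card_image_of_injective _ (fun i j h => (Prod.mk.inj h).1), add_assoc,
    Finset.card_erase_add_one hs]

/-! ### Palindromic suffixes of the Fibonacci words -/

/-- This prefix ends with `a`, so its nonempty palindromic suffixes are the words `σ(u)a`, `u` a
possibly empty palindromic suffix of the shorter prefix; the additional one is the empty suffix. -/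
theorem card_palSuffixes_sigmaPos_add_one (n : ℕ) :
    (palSuffixes (sigmaPos n + 1)).card = (palSuffixes n).card + 1 := by
  have h : palSuffixes (sigmaPos n + 1) =
      insert (sigmaPos n + 1) ((palSuffixes n).image sigmaPos) := by
    ext x
    rw [Finset.mem_insert, Finset.mem_image, mem_palSuffixes]
    constructor
    · rintro ⟨h, hp⟩
      rcases h.eq_or_lt with rfl | h
      · exact Or.inl rfl
      · have hx := (hp.fibSeq_eq (by omega)).trans (fibSeq_sigmaPos n)
        obtain ⟨i, j, hij, hp', rfl, hj⟩ := isPal_from_a_iff.1 ⟨h, hp, hx⟩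
        obtain rfl := sigmaPos_strictMono.injective (Nat.succ_injective hj)
        exact Or.inr ⟨i, mem_palSuffixes.2 ⟨hij, hp'⟩, rfl⟩
    · rintro (rfl | ⟨i, hi, rfl⟩)
      · exact ⟨le_rfl, isPal_self _⟩
      · obtain ⟨h, hp⟩ := mem_palSuffixes.1 hi
        exact ⟨(sigmaPos_strictMono.monotone h).trans (Nat.le_succ _), (isPal_sigmaPos h).2 hp⟩
  rw [h, Finset.card_insert_of_notMem, Finset.card_image_of_injective _
    sigmaPos_strictMono.injective]
  rw [Finset.mem_image]
  rintro ⟨i, hi, h⟩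
  have := sigmaPos_strictMono.monotone (mem_palSuffixes.1 hi).1
  omega

/-- Here the image ends with `b`, so the correspondence for palindromes starting with `b` pairs the
nonempty suffixes, and the empty ones match each other. -/
theorem card_palSuffixes_sigmaPos {n : ℕ} (hn : fibSeq n = Letter.a) :
    (palSuffixes (sigmaPos (n + 1))).card = (palSuffixes (n + 1)).card := by
  have h1 : n + 1 ∈ palSuffixes (n + 1) := mem_palSuffixes.2 ⟨le_rfl, isPal_self _⟩
  have h2 : sigmaPos (n + 1) ∈ palSuffixes (sigmaPos (n + 1)) :=
    mem_palSuffixes.2 ⟨le_rfl, isPal_self _⟩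
  have hs := sigmaPos_succ_of_a hn
  rw [← Finset.card_erase_add_one h1, ← Finset.card_erase_add_one h2]
  congr 1
  symm
  refine Finset.card_bij (fun i _ => sigmaPos i + 1) ?_ ?_ ?_
  · intro i hi
    simp only [Finset.mem_erase, mem_palSuffixes] at hi ⊢
    obtain ⟨h, h', hp⟩ := hi
    have hi := (hp.fibSeq_eq (by omega)).trans hn
    obtain ⟨h3, h4, -⟩ := isPal_from_b_iff.2 ⟨i, n + 1, by omega, hp, hi, rfl, rfl⟩
    exact ⟨h3.ne, h3.le, h4⟩
  · intro i _ j _ h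
    exact sigmaPos_strictMono.injective (Nat.succ_injective h)
  · intro x hx
    simp only [Finset.mem_erase, mem_palSuffixes] at hx
    obtain ⟨h, h', hp⟩ := hx
    have hb : fibSeq x = Letter.b := by
      rw [← fibSeq_sigmaPos_add_one hn]
      rw [hs] at hp
      exact hp.fibSeq_eq (by omega)
    obtain ⟨i, j, hij, hp', -, rfl, hj⟩ := isPal_from_b_iff.1 ⟨by omega, hp, hb⟩
    obtain rfl := sigmaPos_strictMono.injective hj
    refine ⟨i, ?_, rfl⟩
    simp only [Finset.mem_erase, mem_palSuffixes]
    exact ⟨hij.ne, hij.le, hp'⟩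

theorem count_a_fibWord_and_length (m : ℕ) :
    (fibWord m).count Letter.a = Nat.fib (m + 1) ∧ (fibWord m).length = f m := by
  have hs (w : List Letter) : (sigma w).count Letter.a = w.length ∧
      (sigma w).length = w.length + w.count Letter.a := by
    induction w with
    | nil => simp [sigma]
    | cons x w ih => cases x <;> simp_all [sigma, sigmaLetter] <;> omega
  induction m with
  | zero => simp [fibWord, f]
  | succ m ih =>
    rw [fibWord_succ, (hs _).1, (hs _).2, ih.1, ih.2, f, f, Nat.fib_add_two (n := m + 1)]
    exact ⟨rfl, add_comm _ _⟩

theorem sigmaPos_f (m : ℕ) : sigmaPos (f m) = f (m + 1) := by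
  rw [sigmaPos, ← (count_a_fibWord_and_length m).2, ← fibWord_eq_block, ← fibWord_succ]
  exact (count_a_fibWord_and_length (m + 1)).2

/-- The last letters of `F_{2k}` and `F_{2k+1}`, and the numbers of palindromic suffixes of these
words and of the words without their last letter. -/
theorem card_palSuffixes_f_aux (k : ℕ) :
    (∃ n, f (2 * k) = n + 1 ∧ fibSeq n = Letter.a ∧ (palSuffixes n).card = k + 1) ∧
      (palSuffixes (f (2 * k))).card = k + 2 ∧ (palSuffixes (f (2 * k + 1))).card = k + 2 := by
  induction k with
  | zero => exact ⟨⟨0, rfl, rfl, by decide⟩, by decide, by decide⟩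
  | succ k ih =>
    obtain ⟨⟨n, hf, ha, hn⟩, -, -⟩ := ih
    -- If `F_{2k}` is `Va`, then `F_{2k+1}` is `σ(V)ab` and `F_{2k+2}` is `σ²(V)aba`; this is why
    -- the count for `V` is carried through the induction.
    have h1 : f (2 * k + 1) = sigmaPos n + 1 + 1 := by
      rw [← sigmaPos_f, hf, sigmaPos_succ_of_a ha]
    have hb := fibSeq_sigmaPos_add_one ha
    have h2 : f (2 * (k + 1)) = sigmaPos (sigmaPos n + 1) + 1 := by
      rw [← sigmaPos_succ_of_b hb, ← h1, sigmaPos_f]; rfl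
    have h3 : (palSuffixes (f (2 * (k + 1)))).card = k + 1 + 2 := by
      rw [h2, card_palSuffixes_sigmaPos_add_one, card_palSuffixes_sigmaPos_add_one, hn]
    refine ⟨⟨sigmaPos (sigmaPos n + 1), h2, fibSeq_sigmaPos _, ?_⟩, h3, ?_⟩
    · rw [card_palSuffixes_sigmaPos (fibSeq_sigmaPos n), card_palSuffixes_sigmaPos_add_one, hn]
    · rw [← sigmaPos_f, h2, card_palSuffixes_sigmaPos (fibSeq_sigmaPos _), ← h2, h3]

theorem card_palSuffixes_f_add (m : ℕ) :
    (palSuffixes (f m)).card + (palSuffixes (f (m + 1))).card = m + 4 := by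
  rcases Nat.even_or_odd' m with ⟨k, rfl | rfl⟩
  · rw [(card_palSuffixes_f_aux k).2.1, (card_palSuffixes_f_aux k).2.2]; omega
  · rw [(card_palSuffixes_f_aux k).2.2, show 2 * k + 1 + 1 = 2 * (k + 1) by ring,
      (card_palSuffixes_f_aux (k + 1)).2.1]
    omega

/-! ### The recurrence and its solution -/

theorem card_palIntervalsFrom_a_f (m : ℕ) :
    (palIntervalsFrom Letter.a (f (m + 1))).card + (palSuffixes (f m)).card =
      (palIntervals (f m)).card + f m + 1 := by
  obtain ⟨n, hn⟩ := Nat.exists_eq_add_of_le' (Nat.one_le_iff_ne_zero.2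
    (Nat.fib_pos.2 (Nat.succ_pos (m + 1))).ne')
  have hn : f m = n + 1 := hn
  -- `h1` involves the prefix of length `f m - 1`; `h2` trades it for the one of length `f m` and
  -- its palindromic suffixes.
  have h1 := card_palIntervalsFrom_a n
  have h2 := card_palIntervals_succ n
  rw [← hn] at h1 h2
  rw [sigmaPos_f] at h1
  omega

/-- Intervals starting with `b` pull back to intervals starting with `a` one level down, hence to
all intervals two levels down. The two suffix counts incurred add up to `m + 4`, and the two units
from `card_palIntervalsFrom_a_f` leave `m + 2`. -/
theorem card_palIntervals_f_add_two (m : ℕ) :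
    (palIntervals (f (m + 2))).card + m + 2 =
      (palIntervals (f (m + 1))).card + (palIntervals (f m)).card + f (m + 2) := by
  have h1 := card_palIntervalsFrom_a_f m
  have h2 := card_palIntervalsFrom_a_f (m + 1)
  have h3 := card_palIntervalsFrom_b (f (m + 1))
  have h4 := card_palIntervals_eq (f (m + 2))
  have h5 := card_palSuffixes_f_add m
  have h6 : f (m + 2) = f m + f (m + 1) := Nat.fib_add_two
  rw [sigmaPos_f] at h3
  simp only [add_assoc, Nat.reduceAdd] at *
  omega

theorem card_palIntervals_f (m : ℕ) :
    ((palIntervals (f m)).card : ℚ) =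
      ((m : ℚ) - 3) / 5 * (f (m + 2) : ℚ) + ((m : ℚ) - 1) / 5 * (f m : ℚ) + (m : ℚ) + 3 := by
  induction m using Nat.twoStepInduction with
  | zero =>
    rw [show (palIntervals (f 0)).card = 1 by decide, show f (0 + 2) = 3 from rfl,
      show f 0 = 1 from rfl]
    norm_num
  | one =>
    rw [show (palIntervals (f 1)).card = 2 by decide, show f (1 + 2) = 5 from rfl,
      show f 1 = 2 from rfl]
    norm_num
  | more m ih1 ih2 =>
    have h : ((palIntervals (f (m + 2))).card : ℚ) + m + 2 =
        (palIntervals (f (m + 1))).card + (palIntervals (f m)).card + f (m + 2) := by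
      exact_mod_cast card_palIntervals_f_add_two m
    have hf (n : ℕ) : (f (n + 2) : ℚ) = f n + f (n + 1) := by
      exact_mod_cast (Nat.fib_add_two : Nat.fib (n + 2 + 2) = _)
    rw [ih1, ih2] at h
    have h4 := hf (m + 2)
    have h3 := hf (m + 1)
    have h2 := hf m
    -- All Fibonacci terms are reduced to `f m` and `f (m + 1)`, after which the goal is linear in
    -- `h`.
    simp only [add_assoc, Nat.reduceAdd] at *
    rw [h3, h2] at h4
    rw [h3, h2] at h
    rw [h4, h2]
    push_cast at *
    linear_combination h

/-! ### From numbered occurrences to intervals -/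

theorem pthOccurrence_injective {ω : List Letter} {p i j : ℕ} (hi : IsPthOccurrence ω p i)
    (hj : IsPthOccurrence ω p j) : i = j := by
  have key {i j : ℕ} (hi : IsPthOccurrence ω p i) (hj : IsPthOccurrence ω p j) : ¬ i < j := by
    intro hij
    have hlt : {k : ℕ | k ≤ i ∧ OccursAt ω k} ⊂ {k : ℕ | k ≤ j ∧ OccursAt ω k} := by
      refine (Set.ssubset_iff_of_subset fun k (hk : k ≤ i ∧ OccursAt ω k) =>
        (⟨hk.1.trans hij.le, hk.2⟩ : k ≤ j ∧ OccursAt ω k)).2 ⟨j, ⟨le_rfl, hj.1⟩, fun h => ?_⟩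
      exact absurd h.1 (not_le.2 hij)
    have := Set.ncard_lt_ncard hlt ((Set.finite_Iic j).subset fun k hk => hk.1)
    rw [hi.2, hj.2] at this
    exact lt_irrefl _ this
  exact le_antisymm (not_lt.1 (key hj hi)) (not_lt.1 (key hi hj))

/-- The map `g` sends an interval to its word and the rank of that occurrence. It is injective
because word and rank determine the starting point, and the length of the word then gives the
endpoint. -/
theorem A_eq_card_palIntervals (n : ℕ) : A n = (palIntervals n).card := by
  let w (x : ℕ × ℕ) : List Letter := block fibSeq x.1 (x.2 - x.1)
  let g (x : ℕ × ℕ) : List Letter × ℕ := (w x, {k : ℕ | k ≤ x.1 ∧ OccursAt (w x) k}.ncard)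
  have hw (x : ℕ × ℕ) : (w x).length = x.2 - x.1 := block_length _ _ _
  have hocc (x : ℕ × ℕ) : IsPthOccurrence (w x) (g x).2 x.1 :=
    ⟨by rw [OccursAt, hw], rfl⟩
  have himg : palindromeOccurrences n = g '' (palIntervals n : Set (ℕ × ℕ)) := by
    ext ⟨ω, p⟩
    constructor
    · rintro ⟨h0, hpal, -, i, hi, hin⟩
      have hwi : w (i, i + ω.length) = ω := by
        simpa only [w, Nat.add_sub_cancel_left, OccursAt] using hi.1
      refine ⟨(i, i + ω.length), mem_palIntervals.2 ⟨?_, hin, ?_⟩, ?_⟩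
      · exact Nat.lt_add_of_pos_right (List.length_pos_iff.2 h0)
      · change (w (i, i + ω.length)).reverse = w (i, i + ω.length)
        rw [hwi]; exact hpal.reverse_eq
      · refine Prod.ext hwi ?_
        simp only [g, hwi]
        exact hi.2
    · rintro ⟨x, hx, hg⟩
      obtain ⟨h1, h2, hp⟩ := mem_palIntervals.1 hx
      rw [← hg]
      refine ⟨?_, List.Palindrome.of_reverse_eq hp, ?_, x.1, hocc x, ?_⟩
      · rw [← List.length_pos_iff]; change 0 < (w x).length; rw [hw]; omega
      · exact (Set.ncard_pos ((Set.finite_Iic x.1).subset fun k hk => hk.1)).2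
          ⟨x.1, le_rfl, (hocc x).1⟩
      · change x.1 + (w x).length ≤ n; rw [hw]; omega
  have hinj : Set.InjOn g (palIntervals n : Set (ℕ × ℕ)) := by
    intro x hx y hy h
    have h1 := (mem_palIntervals.1 hx).1
    have h2 := (mem_palIntervals.1 hy).1
    have hwxy : w x = w y := congrArg Prod.fst h
    have hy' := hocc y
    rw [← hwxy, ← congrArg Prod.snd h] at hy'
    have h3 := pthOccurrence_injective (hocc x) hy'
    have h4 := congrArg List.length hwxy
    rw [hw, hw] at h4
    exact Prod.ext h3 (by omega)
  rw [A, himg, hinj.ncard_image, Set.ncard_coe_finset]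

end FibPal

theorem mainTheorem1 (m : ℕ) :
    (FibPal.A (FibPal.f m) : ℚ) =
      ((m : ℚ) - 3) / 5 * (FibPal.f (m + 2) : ℚ) + ((m : ℚ) - 1) / 5 * (FibPal.f m : ℚ) +
        (m : ℚ) + 3 := by
  rw [FibPal.A_eq_card_palIntervals, FibPal.card_palIntervals_f]
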